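/- Let $m\ge 0$ and let $K$ be a simplicial complex on $[m]=\{1,\dots,m\}$, i.e. a family of subsets of $[m]$ that contains $\varnothing$ and is closed under taking subsets (not every $\{i\}$ is required to belong to $K$). Let $N(K)$ be the set of minimal non-simplices of $K$: the subsets $\omega\subseteq[m]$ with $\omega\notin K$ all of whose proper subsets belong to $K$. Let $$\mathcal Z_K=\{(z_1,\dots,z_m)\in\mathbb C^m:\ |z_i|\le 1\text{ for all } i,\ \{i: |z_i|\ne 1\}\in K\}$$ be the moment-angle complex, on which $T^m=(S^1)^m$ acts by coordinatewise multiplication. The Buchstaber invariant $s(K)$ is the maximal $s$ for which there is a subgroup $H\subseteq T^m$, isomorphic to $T^s$ as a topological group, that acts freely on $\mathcal Z_K$. Theorem. 1. $s(K)\ge 1$ if and only if $N(K)\neq\varnothing$ (equivalently, $K$ is not the full simplex $2^{[m]}$). 2. $s(K)\ge 2$ if and only if $N(K)$ contains three distinct sets $\tau_1,\tau_2,\tau_3$ with $\tau_1\cap\tau_2\cap\tau_3=\varnothing$, or two distinct sets $\tau_1,\tau_2$ with $\tau_1\cap\tau_2=\varnothing$. 3. $s(K)\ge 3$ if and only if $N(K)$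 contains one of the following configurations of pairwise distinct sets: (a) $\tau_1,\dots,\tau_7$ with $\tau_1\cap\tau_2\cap\tau_4=\tau_1\cap\tau_3\cap\tau_5=\tau_1\cap\tau_6\cap\tau_7=\tau_2\cap\tau_3\cap\tau_6=\tau_2\cap\tau_5\cap\tau_7=\tau_3\cap\tau_4\cap\tau_7=\tau_4\cap\tau_5\cap\tau_6=\varnothing$; (b) $\tau_1,\dots,\tau_6$ with $\tau_1\cap\tau_3=\tau_1\cap\tau_2\cap\tau_4=\tau_1\cap\tau_2\cap\tau_5=\tau_1\cap\tau_4\cap\tau_6=\tau_1\cap\tau_5\cap\tau_6=\tau_2\cap\tau_3\cap\tau_6=\tau_3\cap\tau_4\cap\tau_5=\varnothing$; (c) $\tau_1,\dots,\tau_5$ with $\tau_1\cap\tau_2=\tau_1\cap\tau_5=\tau_1\cap\tau_3\cap\tau_4=\tau_2\cap\tau_3\cap\tau_5=\tau_2\cap\tau_4\cap\tau_5=\varnothing$; (d) $\tau_1,\dots,\tau_4$ with $\tau_1\cap(\tau_2\cup\tau_3\cup\tau_4)=\varnothing$ and $\tau_2\cap\tau_3\cap\tau_4=\varnothing$; (e)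 $\tau_1,\tau_2,\tau_3$ with $\tau_1\cap\tau_2=\tau_1\cap\tau_3=\tau_2\cap\tau_3=\varnothing$. -/

import Mathlib

/-! A simplicial complex on the vertex set `{1, …, m}` is a `PreAbstractSimplicialComplex (Fin m)`.
Mathlib records only the nonempty faces and does not require every vertex to be a face; the empty
set, which is a simplex of every complex, is added by `BuchstaberInv.IsSimplex`. -/

namespace BuchstaberInv

/-- `σ` is a simplex of `K` (the empty set always is). -/
def IsSimplex {m : ℕ} (K : PreAbstractSimplicialComplex (Fin m)) (σ : Finset (Fin m)) : Prop :=
  σ = ∅ ∨ σ ∈ K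

/-- The set `N(K)` of minimal non-simplices: non-simplices all of whose proper subsets are
simplices. -/
def minNonSimplices {m : ℕ} (K : PreAbstractSimplicialComplex (Fin m)) :
    Set (Finset (Fin m)) :=
  {ω | ¬ IsSimplex K ω ∧ ∀ σ : Finset (Fin m), σ ⊂ ω → IsSimplex K σ}

/-- The `K`-power `(X, A)^K` of a pair of subsets `A ⊆ X` of an ambient space `E`: the points
`x ∈ X ^ m` such that `{i | x i ∉ A}` is a simplex of `K`. -/
def kPower {m : ℕ} {E : Type*} (K : PreAbstractSimplicialComplex (Fin m)) (X A : Set E) :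
    Set (Fin m → E) :=
  {x | (∀ i, x i ∈ X) ∧ ∃ σ : Finset (Fin m), IsSimplex K σ ∧ ∀ i, i ∈ σ ↔ x i ∉ A}

/-- The moment-angle complex `Z_K = (D², S¹)^K`. -/
def momentAngleComplex {m : ℕ} (K : PreAbstractSimplicialComplex (Fin m)) :
    Set (Fin m → ℂ) :=
  kPower K (Metric.closedBall (0 : ℂ) 1) (Metric.sphere (0 : ℂ) 1)

/-- The coordinatewise action of the torus `T^m` preserves `Z_K`. -/
theorem mul_mem_momentAngleComplex {m : ℕ} (K : PreAbstractSimplicialComplex (Fin m))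
    (t : Fin m → Circle) {z : Fin m → ℂ} (hz : z ∈ momentAngleComplex K) :
    (fun i => (t i : ℂ) * z i) ∈ momentAngleComplex K := by
  obtain ⟨h1, σ, hσ, h2⟩ := hz
  refine ⟨fun i => ?_, σ, hσ, fun i => ?_⟩
  · have h : ‖(t i : ℂ)‖ = 1 := Circle.norm_coe (t i)
    simpa [norm_mul, h] using h1 i
  · have h : ‖(t i : ℂ)‖ = 1 := Circle.norm_coe (t i)
    simpa [norm_mul, h] using h2 i

/-- The canonical coordinatewise action of the torus `T^m` on `Z_K`. -/
noncomputable instance torusAction {m : ℕ} (K : PreAbstractSimplicialComplex (Fin m)) :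
    MulAction (Fin m → Circle) (momentAngleComplex K) where
  smul t z := ⟨fun i => (t i : ℂ) * z.1 i, mul_mem_momentAngleComplex K t z.2⟩
  one_smul z := Subtype.ext (funext fun i => by
    change ((1 : Circle) : ℂ) * z.1 i = z.1 i
    simp)
  mul_smul s t z := Subtype.ext (funext fun i => by
    change ((s i * t i : Circle) : ℂ) * z.1 i = (s i : ℂ) * ((t i : ℂ) * z.1 i)
    simp [mul_assoc])

/-- The subgroup `H` of `T^m` acts freely on `Z_K`. -/
def ActsFreely {m : ℕ} (K : PreAbstractSimplicialComplex (Fin m))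
    (H : Subgroup (Fin m → Circle)) : Prop :=
  ∀ t ∈ H, ∀ z : momentAngleComplex K, t • z = z → t = 1

/-- The dimensions `s` of the toric subgroups `H ≃ T^s` of `T^m` that act freely on `Z_K`; the
isomorphism is one of topological groups. -/
def freeToricDims {m : ℕ} (K : PreAbstractSimplicialComplex (Fin m)) : Set ℕ :=
  {s | ∃ H : Subgroup (Fin m → Circle), Nonempty (H ≃ₜ* (Fin s → Circle)) ∧ ActsFreely K H}

/-- The Buchstaber invariant `s(K)`: the maximal dimension of a toric subgroup of `T^m` that acts
freely on `Z_K`. -/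
noncomputable def buchstaberInvariant {m : ℕ} (K : PreAbstractSimplicialComplex (Fin m)) : ℕ :=
  sSup (freeToricDims K)

theorem le_of_toric {m s : ℕ} (H : Subgroup (Fin m → Circle)) (e : H ≃* (Fin s → Circle)) :
    s ≤ m := by
  classical
  let v : (Fin s → Bool) → (Fin s → Circle) := fun b i => if b i then -1 else 1
  have hne : (-1 : Circle) ≠ 1 := by
    intro h
    have h2 := congrArg (fun c : Circle => (c : ℂ)) h
    norm_num at h2
  have hv : ∀ b, v b * v b = 1 := by
    intro b
    funext i
    by_cases h : b i <;> simp [v, h]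
  have hinj : Function.Injective v := by
    intro a b hab
    funext i
    have hi := congrFun hab i
    cases ha : a i <;> cases hb : b i <;> simp [v, ha, hb, hne, hne.symm] at hi ⊢
  have hw : ∀ b i, (e.symm (v b)).1 i = 1 ∨ (e.symm (v b)).1 i = -1 := by
    intro b i
    have h1 : e.symm (v b) * e.symm (v b) = 1 := by rw [← map_mul, hv, map_one]
    have h2 : (e.symm (v b)).1 i * (e.symm (v b)).1 i = 1 :=
      congrFun (congrArg Subtype.val h1) i
    have h3 : (((e.symm (v b)).1 i : Circle) : ℂ) * (((e.symm (v b)).1 i : Circle) : ℂ) = 1 := by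
      rw [← Circle.coe_mul, h2, Circle.coe_one]
    rcases mul_self_eq_one_iff.mp h3 with h | h
    · exact Or.inl (Circle.ext (by simpa using h))
    · exact Or.inr (Circle.ext (by simpa using h))
  let f : (Fin s → Bool) → (Fin m → Bool) := fun b i => decide ((e.symm (v b)).1 i = 1)
  have hf : Function.Injective f := by
    intro a b hab
    apply hinj
    apply e.symm.injective
    apply Subtype.ext
    funext i
    have hi : ((e.symm (v a)).1 i = 1) ↔ ((e.symm (v b)).1 i = 1) := by
      simpa [f] using congrFun hab i
    rcases hw a i with h | h <;> rcases hw b i with h' | h'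
    · rw [h, h']
    · exact absurd (h'.symm.trans (hi.mp h)) hne
    · exact absurd (h.symm.trans (hi.mpr h')) hne
    · rw [h, h']
  have hcard := Fintype.card_le_of_injective f hf
  simp only [Fintype.card_fun, Fintype.card_bool, Fintype.card_fin] at hcard
  exact (Nat.pow_le_pow_iff_right (by norm_num)).mp hcard

/-- The maximum in the definition of `s(K)` exists. -/
theorem isGreatest_buchstaberInvariant {m : ℕ} (K : PreAbstractSimplicialComplex (Fin m)) :
    IsGreatest (freeToricDims K) (buchstaberInvariant K) := by
  have hb : BddAbove (freeToricDims K) :=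
    ⟨m, fun s ⟨H, ⟨e⟩, _⟩ => le_of_toric H e.toMulEquiv⟩
  have hn : (freeToricDims K).Nonempty := by
    refine ⟨0, ⊥, ⟨?_⟩, ?_⟩
    · exact
        { toFun := fun _ => 1
          invFun := fun _ => 1
          left_inv := fun _ => Subsingleton.elim _ _
          right_inv := fun _ => Subsingleton.elim _ _
          map_mul' := fun _ _ => Subsingleton.elim _ _
          continuous_toFun := continuous_const
          continuous_invFun := continuous_const }
    · intro t ht _ _
      exact Subgroup.mem_bot.mp ht
  exact ⟨Nat.sSup_mem hn hb, fun s hs => le_csSup hb hs⟩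

/-- The family `N` contains the subset whose (pairwise distinct) members are listed in `l`. -/
def ContainsDistinct {α : Type*} (N : Set α) (l : List α) : Prop :=
  l.Nodup ∧ ∀ τ ∈ l, τ ∈ N

/-- Condition (S1). -/
def ConditionS1 {α : Type*} (N : Set (Finset α)) : Prop :=
  N.Nonempty

/-- Condition (S2). -/
def ConditionS2 {α : Type*} [DecidableEq α] (N : Set (Finset α)) : Prop :=
  (∃ τ₁ τ₂ τ₃ : Finset α, ContainsDistinct N [τ₁, τ₂, τ₃] ∧ τ₁ ∩ τ₂ ∩ τ₃ = ∅) ∨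
  (∃ τ₁ τ₂ : Finset α, ContainsDistinct N [τ₁, τ₂] ∧ τ₁ ∩ τ₂ = ∅)

/-- Condition (S3). -/
def ConditionS3 {α : Type*} [DecidableEq α] (N : Set (Finset α)) : Prop :=
  (∃ τ₁ τ₂ τ₃ τ₄ τ₅ τ₆ τ₇ : Finset α, ContainsDistinct N [τ₁, τ₂, τ₃, τ₄, τ₅, τ₆, τ₇] ∧
    τ₁ ∩ τ₂ ∩ τ₄ = ∅ ∧ τ₁ ∩ τ₃ ∩ τ₅ = ∅ ∧ τ₁ ∩ τ₆ ∩ τ₇ = ∅ ∧ τ₂ ∩ τ₃ ∩ τ₆ = ∅ ∧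
    τ₂ ∩ τ₅ ∩ τ₇ = ∅ ∧ τ₃ ∩ τ₄ ∩ τ₇ = ∅ ∧ τ₄ ∩ τ₅ ∩ τ₆ = ∅) ∨
  (∃ τ₁ τ₂ τ₃ τ₄ τ₅ τ₆ : Finset α, ContainsDistinct N [τ₁, τ₂, τ₃, τ₄, τ₅, τ₆] ∧
    τ₁ ∩ τ₃ = ∅ ∧ τ₁ ∩ τ₂ ∩ τ₄ = ∅ ∧ τ₁ ∩ τ₂ ∩ τ₅ = ∅ ∧ τ₁ ∩ τ₄ ∩ τ₆ = ∅ ∧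
    τ₁ ∩ τ₅ ∩ τ₆ = ∅ ∧ τ₂ ∩ τ₃ ∩ τ₆ = ∅ ∧ τ₃ ∩ τ₄ ∩ τ₅ = ∅) ∨
  (∃ τ₁ τ₂ τ₃ τ₄ τ₅ : Finset α, ContainsDistinct N [τ₁, τ₂, τ₃, τ₄, τ₅] ∧
    τ₁ ∩ τ₂ = ∅ ∧ τ₁ ∩ τ₅ = ∅ ∧ τ₁ ∩ τ₃ ∩ τ₄ = ∅ ∧ τ₂ ∩ τ₃ ∩ τ₅ = ∅ ∧
    τ₂ ∩ τ₄ ∩ τ₅ = ∅) ∨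
  (∃ τ₁ τ₂ τ₃ τ₄ : Finset α, ContainsDistinct N [τ₁, τ₂, τ₃, τ₄] ∧
    τ₁ ∩ (τ₂ ∪ τ₃ ∪ τ₄) = ∅ ∧ τ₂ ∩ τ₃ ∩ τ₄ = ∅) ∨
  (∃ τ₁ τ₂ τ₃ : Finset α, ContainsDistinct N [τ₁, τ₂, τ₃] ∧
    τ₁ ∩ τ₂ = ∅ ∧ τ₁ ∩ τ₃ = ∅ ∧ τ₂ ∩ τ₃ = ∅)

end BuchstaberInv

/-!
Elements of order two in a freely acting torus of rank `s` form, together with `1`, a copy of `𝔽₂ˢ`,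
and the support of each of them is not a simplex. Choosing a minimal non-simplex inside every
support gives a family indexed by the nonzero vectors of `𝔽₂ˢ`, and any three vectors with sum zero
have members without a common vertex, since a product of two signs `-1` is `1`.

Conversely, let such a family be given with `s ≤ 3`. The vectors whose members contain a given
vertex contain no line, so they lie on an affine hyperplane off the origin, that is, some linear
form `𝔽₂ˢ → 𝔽₂` equals `1` on all of them. These forms are the rows of a matrix over `𝔽₂`; since no
member lies in a simplex, the rows outside a simplex have rank `s`. Lift the matrix to entries `0`
and `1` in `ℤ`. An `s × s` minor that is nonzero over `𝔽₂` is odd, and `0`-`1` determinants of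
size at most three have absolute value at most two, so the minor is `±1` and the torus homomorphism
with this exponent matrix has a freely acting image.

For `s = 3` the families are exactly configurations (a) with repetitions allowed. A coincidence
between members makes some of the triple intersections pairwise, which turns the family into one of
the configurations (b) to (e).
-/

namespace BuchstaberInv

section LinearAlgebra

variable {V : Type*} [AddCommGroup V] [Module (ZMod 2) V]

theorem exists_subset_sum_eq_of_mem_span_zmod_two {t : Finset V} {b : V}
    (hb : b ∈ Submodule.span (ZMod 2) (t : Set V)) : ∃ J ⊆ t, ∑ x ∈ J, x = b := by
  obtain ⟨c, -, rfl⟩ := Submodule.mem_span_finset.mp hb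
  refine ⟨t.filter (c · = 1), Finset.filter_subset _ _, ?_⟩
  rw [Finset.sum_filter]
  refine Finset.sum_congr rfl fun x _ ↦ ?_
  obtain h | h : c x = 0 ∨ c x = 1 := by generalize c x = a; revert a; decide
  all_goals simp [h]

/- A set of vectors over `𝔽₂` lies on an affine hyperplane off the origin as soon as no odd number
of its elements sums to zero. A minimal dependency has at most `dim V + 1 ≤ 4` elements, so only
sums of one or three elements matter. -/
theorem exists_dual_eq_one_of_add_add_ne_zero [Module.Finite (ZMod 2) V]
    (hV : Module.finrank (ZMod 2) V ≤ 3) {B : Set V}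
    (hB : ∀ u ∈ B, ∀ v ∈ B, ∀ w ∈ B, u + v + w ≠ 0) :
    ∃ f : Module.Dual (ZMod 2) V, ∀ b ∈ B, f b = 1 := by
  classical
  obtain ⟨t, htB, htcard, htspan, htli⟩ := Submodule.exists_finset_span_eq_linearIndepOn (ZMod 2) B
  obtain ⟨f, hf⟩ : ∃ f : Module.Dual (ZMod 2) V, ∀ x ∈ t, f x = 1 :=
    Module.exists_dual_forall_apply_eq_one htli
  refine ⟨f, fun b hb ↦ ?_⟩
  obtain ⟨J, hJt, rfl⟩ :=
    exists_subset_sum_eq_of_mem_span_zmod_two (htspan ▸ Submodule.subset_span hb)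
  have hfJ : f (∑ x ∈ J, x) = J.card := by
    rw [map_sum, Finset.sum_congr rfl fun x hx ↦ hf x (hJt hx)]
    simp
  have hJcard : J.card ≤ 3 := by
    grw [hJt, htcard, Submodule.finrank_le, hV]
  have hJ0 : J.card ≠ 0 := by
    rw [Finset.card_ne_zero, Finset.nonempty_iff_ne_empty]
    rintro rfl
    exact hB _ hb _ hb _ hb (by simp)
  have hJ2 : J.card ≠ 2 := by
    intro h
    obtain ⟨x, y, hxy, rfl⟩ := Finset.card_eq_two.mp h
    rw [Finset.sum_pair hxy] at hb
    exact hB x (htB (hJt (by simp))) y (htB (hJt (by simp))) _ hb (ZModModule.add_self _)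
  rw [hfJ]
  obtain h | h : J.card = 1 ∨ J.card = 3 := by lia
  all_goals rw [h]; decide

theorem exists_isUnit_det_submatrix {F ι : Type*} [Field F] [Finite ι] {n : ℕ}
    {A : Matrix ι (Fin n) F} (hA : Function.Injective A.mulVec) :
    ∃ ρ : Fin n → ι, IsUnit (A.submatrix ρ id).det := by
  have hrank : Module.finrank F (Submodule.span F (Set.range A.row)) = n := by
    rw [← A.rank_eq_finrank_span_row, Matrix.rank, LinearMap.finrank_range_of_inj hA,
      Module.finrank_fin_fun]
  have hrows := Submodule.exists_fun_fin_finrank_span_eq F (Set.range A.row)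
  rw [hrank] at hrows
  obtain ⟨r, hr, -, hli⟩ := hrows
  choose ρ hρ using hr
  refine ⟨ρ, (Matrix.isUnit_iff_isUnit_det _).mp (Matrix.linearIndependent_rows_iff_isUnit.mp ?_)⟩
  rwa [show (A.submatrix ρ id).row = r from funext hρ]

theorem mul_mem_Icc_zero_one {R : Type*} [Semiring R] [PartialOrder R] [IsOrderedRing R] {x y : R}
    (hx : x ∈ Set.Icc 0 1) (hy : y ∈ Set.Icc 0 1) : x * y ∈ Set.Icc 0 1 :=
  ⟨mul_nonneg hx.1 hy.1, mul_le_one₀ hx.2 hy.1 hy.2⟩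

theorem abs_det_fin_three_le_two {A : Matrix (Fin 3) (Fin 3) ℤ}
    (hA : ∀ i j, A i j ∈ Set.Icc 0 1) : |A.det| ≤ 2 := by
  by_cases hone : ∀ i j, A i j = 1
  · simp [Matrix.det_fin_three, hone]
  -- Every entry occurs in one positive and in one negative term of the Leibniz expansion, so a zero
  -- entry leaves at most two nonzero terms of each sign.
  obtain ⟨i, j, hij⟩ : ∃ i j, A i j = 0 := by
    push Not at hone
    obtain ⟨i, j, hij⟩ := hone
    exact ⟨i, j, by have := hA i j; simp only [Set.mem_Icc] at this; lia⟩
  have hterm (k l p : Fin 3) : A 0 k * A 1 l * A 2 p ∈ Set.Icc 0 1 :=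
    mul_mem_Icc_zero_one (mul_mem_Icc_zero_one (hA 0 k) (hA 1 l)) (hA 2 p)
  have h₁ := hterm 0 1 2
  have h₂ := hterm 0 2 1
  have h₃ := hterm 1 0 2
  have h₄ := hterm 1 2 0
  have h₅ := hterm 2 0 1
  have h₆ := hterm 2 1 0
  rw [Matrix.det_fin_three, abs_le]
  fin_cases i <;> fin_cases j <;> dsimp at hij <;>
    simp only [hij, zero_mul, mul_zero, Set.mem_Icc] at h₁ h₂ h₃ h₄ h₅ h₆ ⊢ <;> lia

theorem abs_det_le_two {n : ℕ} (hn : n ≤ 3) {A : Matrix (Fin n) (Fin n) ℤ}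
    (hA : ∀ i j, A i j ∈ Set.Icc 0 1) : |A.det| ≤ 2 := by
  interval_cases n
  · simp
  · have := hA 0 0
    rw [Matrix.det_fin_one, abs_le]
    grind
  · have := mul_mem_Icc_zero_one (hA 0 0) (hA 1 1)
    have := mul_mem_Icc_zero_one (hA 0 1) (hA 1 0)
    rw [Matrix.det_fin_two, abs_le]
    grind
  · exact abs_det_fin_three_le_two hA

theorem isUnit_det_lift_of_isUnit_det_zmod_two {n : ℕ} (hn : n ≤ 3)
    {A : Matrix (Fin n) (Fin n) (ZMod 2)} (hA : IsUnit A.det) :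
    IsUnit (A.map fun x ↦ (x.val : ℤ)).det := by
  set B : Matrix (Fin n) (Fin n) ℤ := A.map fun x ↦ (x.val : ℤ)
  have hB : |B.det| ≤ 2 := abs_det_le_two hn fun i j ↦ by
    have := ZMod.val_lt (A i j)
    simp only [B, Matrix.map_apply, Set.mem_Icc]
    lia
  have hcast : ((B.det : ℤ) : ZMod 2) = A.det := by
    rw [Int.cast_det]
    congr
    ext i j
    simp [B]
  have hodd : Odd B.det := by
    rw [← Int.not_even_iff_odd, ← ZMod.intCast_eq_zero_iff_even, hcast]
    exact hA.ne_zero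
  rw [Int.isUnit_iff]
  grind

end LinearAlgebra

section Simplices

variable {m : ℕ} {K : PreAbstractSimplicialComplex (Fin m)}

theorem isSimplex_empty : IsSimplex K ∅ := Or.inl rfl

theorem IsSimplex.mono {σ τ : Finset (Fin m)} (hσ : IsSimplex K σ) (h : τ ⊆ σ) :
    IsSimplex K τ := by
  rcases τ.eq_empty_or_nonempty with rfl | hτ
  · exact isSimplex_empty
  rcases hσ with rfl | hσ
  · exact absurd (Finset.subset_empty.mp h) hτ.ne_empty
  · exact Or.inr ((K.isRelLowerSet_faces hσ).2 h hτ)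

theorem empty_notMem_minNonSimplices : ∅ ∉ minNonSimplices K := fun h ↦ h.1 isSimplex_empty

theorem mem_minNonSimplices_iff_minimal {ω : Finset (Fin m)} :
    ω ∈ minNonSimplices K ↔ Minimal (fun σ ↦ ¬ IsSimplex K σ) ω := by
  rw [minimal_iff_forall_lt]
  simp [minNonSimplices]

theorem exists_subset_mem_minNonSimplices {ω : Finset (Fin m)} (hω : ¬ IsSimplex K ω) :
    ∃ τ ⊆ ω, τ ∈ minNonSimplices K := by
  simp only [mem_minNonSimplices_iff_minimal]
  exact exists_minimal_le_of_wellFoundedLT _ ω hω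

theorem conditionS1_iff :
    ConditionS1 (minNonSimplices K) ↔ ¬ ∀ σ : Finset (Fin m), IsSimplex K σ := by
  constructor
  · rintro ⟨τ, hτ⟩ h
    exact hτ.1 (h τ)
  · intro h
    push Not at h
    obtain ⟨ω, hω⟩ := h
    obtain ⟨τ, -, hτ⟩ := exists_subset_mem_minNonSimplices hω
    exact ⟨τ, hτ⟩

end Simplices

section MonomialMap

variable {ι κ l G : Type*} [Fintype κ] [CommGroup G]

/-- The homomorphism `G ^ κ → G ^ ι` whose coordinates are the monomials with exponents the rows of
an integer matrix. For `G = Circle` these are the continuous homomorphisms between tori. -/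
def monomialMap (A : Matrix ι κ ℤ) : (κ → G) →* (ι → G) where
  toFun t i := ∏ j, t j ^ A i j
  map_one' := by
    ext i
    simp
  map_mul' t u := by
    ext i
    simp [mul_zpow, Finset.prod_mul_distrib]

theorem monomialMap_apply (A : Matrix ι κ ℤ) (t : κ → G) (i : ι) :
    monomialMap A t i = ∏ j, t j ^ A i j := rfl

theorem monomialMap_mul [Fintype ι] (A : Matrix l ι ℤ) (B : Matrix ι κ ℤ) (t : κ → G) :
    monomialMap (A * B) t = monomialMap A (monomialMap B t) := by
  ext i
  simp only [monomialMap_apply, Matrix.mul_apply, ← Finset.prod_zpow, ← zpow_mul]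
  rw [Finset.prod_comm]
  refine Finset.prod_congr rfl fun j _ ↦ ?_
  simp only [mul_comm (B _ j)]
  exact Finset.sum_smul (R := ℤ) (x := Additive.ofMul (t j))

theorem monomialMap_one [DecidableEq κ] (t : κ → G) : monomialMap (1 : Matrix κ κ ℤ) t = t := by
  ext i
  simp [monomialMap_apply, Matrix.one_apply]

theorem monomialMap_injective [DecidableEq κ] {A : Matrix κ κ ℤ} (hA : IsUnit A.det) :
    Function.Injective (monomialMap A : (κ → G) →* (κ → G)) :=
  Function.LeftInverse.injective (g := monomialMap A⁻¹) fun t ↦ by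
    rw [← monomialMap_mul, A.nonsing_inv_mul hA, monomialMap_one]

theorem monomialMap_lift_injective {n : ℕ} (hn : n ≤ 3) [Finite ι] {A : Matrix ι (Fin n) (ZMod 2)}
    (hA : Function.Injective A.mulVec) : Function.Injective
      (monomialMap (A.map fun x ↦ (x.val : ℤ)) : (Fin n → G) →* (ι → G)) := by
  obtain ⟨ρ, hρ⟩ := exists_isUnit_det_submatrix hA
  exact fun t u htu ↦ monomialMap_injective (isUnit_det_lift_of_isUnit_det_zmod_two hn hρ)
    (funext fun i ↦ congrFun htu (ρ i))

theorem continuous_monomialMap [TopologicalSpace G] [IsTopologicalGroup G] (A : Matrix ι κ ℤ) :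
    Continuous (monomialMap A : (κ → G) →* (ι → G)) :=
  continuous_pi fun i ↦ continuous_finsetProd _ fun j _ ↦ (continuous_apply j).zpow (A i j)

end MonomialMap

/-- A family of members of `N` indexed by the nonzero vectors of an `𝔽₂`-vector space, with empty
intersection along every line of the associated projective space. The value at `0` is irrelevant. -/
structure IsLineDisjoint {V α : Type*} [AddCommGroup V] [DecidableEq α]
    (N : Set (Finset α)) (F : V → Finset α) : Prop where
  mem : ∀ u, u ≠ 0 → F u ∈ N
  inter_eq_empty : ∀ u v w, u ≠ 0 → v ≠ 0 → w ≠ 0 → u + v + w = 0 → F u ∩ F v ∩ F w = ∅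

section Freeness

variable {m : ℕ} {K : PreAbstractSimplicialComplex (Fin m)} {H : Subgroup (Fin m → Circle)}

-- The stabilizer of a point `z` of `Z_K` is the coordinate subtorus on the simplex `{i | z i = 0}`.
theorem actsFreely_iff :
    ActsFreely K H ↔ ∀ t ∈ H, ∀ σ : Finset (Fin m), IsSimplex K σ →
      Function.mulSupport t ⊆ σ → t = 1 := by
  constructor
  · intro h t ht σ hσ hsupp
    let z : Fin m → ℂ := fun i ↦ if i ∈ σ then 0 else 1
    have hz : z ∈ momentAngleComplex K := by
      refine ⟨fun i ↦ ?_, σ, hσ, fun i ↦ ?_⟩ <;> by_cases hi : i ∈ σ <;> simp [z, hi]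
    refine h t ht ⟨z, hz⟩ (Subtype.ext (funext fun i ↦ ?_))
    change (t i : ℂ) * z i = z i
    by_cases hi : i ∈ σ
    · simp [z, hi]
    · rw [Function.notMem_mulSupport.mp fun hit ↦ hi (hsupp hit), Circle.coe_one, one_mul]
  · rintro h t ht ⟨z, hz⟩ hfix
    have htz (i) : (t i : ℂ) * z i = z i := congrFun (congrArg Subtype.val hfix) i
    obtain ⟨-, σ, hσ, hσz⟩ := hz
    refine h t ht σ hσ fun i hi ↦ (hσz i).mpr fun hzi ↦ hi ?_
    have hzi₀ : z i ≠ 0 := ne_zero_of_mem_unit_sphere (⟨z i, hzi⟩ : Metric.sphere (0 : ℂ) 1)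
    exact Circle.ext (by simpa [hzi₀] using htz i)

theorem ActsFreely.exists_mem_minNonSimplices (hH : ActsFreely K H) {t : Fin m → Circle}
    (ht : t ∈ H) (ht₁ : t ≠ 1) : ∃ τ ∈ minNonSimplices K, (τ : Set (Fin m)) ⊆ t.mulSupport := by
  classical
  obtain ⟨τ, hτt, hτ⟩ := exists_subset_mem_minNonSimplices
    (K := K) (ω := t.mulSupport.toFinset) fun hσ ↦
      ht₁ (actsFreely_iff.mp hH t ht _ hσ (by simp))
  exact ⟨τ, hτ, by simpa using Finset.coe_subset.mpr hτt⟩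

theorem circle_eq_neg_one_of_mul_self_eq_one {z : Circle} (hz : z * z = 1) (hz₁ : z ≠ 1) :
    z = -1 := by
  have h : (z : ℂ) * z = 1 := by rw [← Circle.coe_mul, hz, Circle.coe_one]
  obtain h | h := mul_self_eq_one_iff.mp h
  · exact absurd (Circle.ext (by simpa using h)) hz₁
  · exact Circle.ext (by simpa using h)

theorem ActsFreely.exists_isLineDisjoint (hH : ActsFreely K H) {V : Type*} [AddCommGroup V]
    [Module (ZMod 2) V] {ψ : AddChar V H} (hψ : Function.Injective ψ) :
    ∃ F : V → Finset (Fin m), IsLineDisjoint (minNonSimplices K) F := by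
  have hne {u : V} (hu : u ≠ 0) : (ψ u : Fin m → Circle) ≠ 1 := by
    rw [Ne, OneMemClass.coe_eq_one, ← ψ.map_zero_eq_one, hψ.eq_iff]
    exact hu
  have hmul (u v : V) (i : Fin m) : (ψ (u + v)).1 i = (ψ u).1 i * (ψ v).1 i := by
    rw [ψ.map_add_eq_mul]; rfl
  have hneg {u : V} {i : Fin m} (hi : (ψ u).1 i ≠ 1) : (ψ u).1 i = -1 := by
    refine circle_eq_neg_one_of_mul_self_eq_one ?_ hi
    rw [← hmul, ZModModule.add_self, ψ.map_zero_eq_one]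
    rfl
  choose! F hF hFsupp using fun (u : V) (hu : u ≠ 0) ↦
    hH.exists_mem_minNonSimplices (ψ u).2 (hne hu)
  refine ⟨F, hF, fun u v w hu hv hw huvw ↦ Finset.eq_empty_of_forall_notMem fun i hi ↦ ?_⟩
  obtain ⟨⟨hiu, hiv⟩, hiw⟩ := by simpa only [Finset.mem_inter] using hi
  apply hFsupp w hw hiw
  rw [← add_eq_zero_iff_neg_eq.mp huvw, ZModModule.neg_eq_self, hmul, hneg (hFsupp u hu hiu),
    hneg (hFsupp v hv hiv), neg_mul_neg, one_mul]

/-- The isomorphism of `𝔽₂ⁿ` onto the elements of order at most two of the torus `Tⁿ`. -/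
noncomputable def signChar (n : ℕ) : AddChar (Fin n → ZMod 2) (Fin n → Circle) where
  toFun u j := ZMod.toCircle (u j)
  map_zero_eq_one' := by
    ext j
    simp
  map_add_eq_mul' u v := by
    ext j
    simp [AddChar.map_add_eq_mul]

theorem signChar_injective (n : ℕ) : Function.Injective (signChar n) := fun _ _ huv ↦
  funext fun j ↦ ZMod.injective_toCircle (congrFun huv j)

theorem exists_isLineDisjoint_of_le_buchstaberInvariant {s : ℕ} (hs : s ≤ buchstaberInvariant K) :
    ∃ F : (Fin s → ZMod 2) → Finset (Fin m), IsLineDisjoint (minNonSimplices K) F := by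
  obtain ⟨H, ⟨e⟩, hH⟩ := (isGreatest_buchstaberInvariant K).1
  obtain ⟨f, hf⟩ := finrank_le_iff_exists_linearMap
    (R := ZMod 2) (M := Fin s → ZMod 2) (M' := Fin (buchstaberInvariant K) → ZMod 2) |>.mp
      (by simpa using hs)
  let ψ : AddChar (Fin s → ZMod 2) H :=
    (e.symm.toMulEquiv.toMonoidHom.compAddChar (signChar _)).compAddMonoidHom f.toAddMonoidHom
  have hψ : Function.Injective ψ :=
    e.symm.injective.comp ((signChar_injective _).comp hf)
  exact hH.exists_isLineDisjoint hψ

theorem le_buchstaberInvariant_of_continuous {s : ℕ} {φ : (Fin s → Circle) →* (Fin m → Circle)}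
    (hφ : Continuous φ) (h : ∀ σ : Finset (Fin m), IsSimplex K σ → ∀ t,
      Function.mulSupport (φ t) ⊆ σ → t = 1) : s ≤ buchstaberInvariant K := by
  have hinj : Function.Injective φ := (injective_iff_map_eq_one φ).mpr fun t ht ↦
    h ∅ isSimplex_empty t (by simp [ht])
  let e : (Fin s → Circle) ≃* φ.range := MonoidHom.ofInjective hinj
  have he : Continuous e := hφ.subtype_mk _
  let e' : (Fin s → Circle) ≃ₜ* φ.range :=
    { e with
      continuous_toFun := he
      continuous_invFun := (he.homeoOfEquivCompactToT2 (f := e.toEquiv)).continuous_symm }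
  refine (isGreatest_buchstaberInvariant K).2 ⟨φ.range, ⟨e'.symm⟩, actsFreely_iff.mpr ?_⟩
  rintro _ ⟨t, rfl⟩ σ hσ hsupp
  rw [h σ hσ t hsupp, map_one]

theorem IsLineDisjoint.exists_dual_eq_one {V α : Type*} [AddCommGroup V] [Module (ZMod 2) V]
    [Module.Finite (ZMod 2) V] [DecidableEq α] {N : Set (Finset α)} {F : V → Finset α}
    (hF : IsLineDisjoint N F) (hV : Module.finrank (ZMod 2) V ≤ 3) (i : α) :
    ∃ a : Module.Dual (ZMod 2) V, ∀ u, u ≠ 0 → i ∈ F u → a u = 1 := by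
  obtain ⟨a, ha⟩ := exists_dual_eq_one_of_add_add_ne_zero hV (B := {u | u ≠ 0 ∧ i ∈ F u}) <| by
    rintro u ⟨hu, hiu⟩ v ⟨hv, hiv⟩ w ⟨hw, hiw⟩ huvw
    have hi : i ∈ F u ∩ F v ∩ F w := by simp [hiu, hiv, hiw]
    simp [hF.inter_eq_empty u v w hu hv hw huvw] at hi
  exact ⟨a, fun u hu hiu ↦ ha u ⟨hu, hiu⟩⟩

theorem IsLineDisjoint.le_buchstaberInvariant {s : ℕ} (hs : s ≤ 3)
    {F : (Fin s → ZMod 2) → Finset (Fin m)} (hF : IsLineDisjoint (minNonSimplices K) F) :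
    s ≤ buchstaberInvariant K := by
  choose a ha using hF.exists_dual_eq_one (by simpa using hs)
  let A : Matrix (Fin m) (Fin s) (ZMod 2) := LinearMap.toMatrix' (LinearMap.pi a)
  refine le_buchstaberInvariant_of_continuous
    (continuous_monomialMap (A.map fun x ↦ (x.val : ℤ))) fun σ hσ t ht ↦ ?_
  have hA : Function.Injective (A.submatrix (Subtype.val : {i // i ∉ σ} → Fin m) id).mulVec := by
    refine (injective_iff_map_eq_zero (Matrix.mulVecLin _)).mpr fun u hu ↦ ?_
    by_contra hu₀
    obtain ⟨i, hiu, hiσ⟩ : ∃ i ∈ F u, i ∉ σ :=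
      Finset.not_subset.mp fun h ↦ (hF.mem u hu₀).1 (hσ.mono h)
    have hau : a i u = 0 := calc
      a i u = A.mulVec u i := (congrFun (LinearMap.toMatrix'_mulVec (LinearMap.pi a) u) i).symm
      _ = 0 := congrFun hu ⟨i, hiσ⟩
    simp [ha i u hu₀ hiu] at hau
  apply monomialMap_lift_injective hs hA
  ext i
  rw [map_one]
  exact congrArg _ (Function.notMem_mulSupport.mp fun hi ↦ i.2 (ht hi))

theorem le_buchstaberInvariant_iff {s : ℕ} (hs : s ≤ 3) :
    s ≤ buchstaberInvariant K ↔
      ∃ F : (Fin s → ZMod 2) → Finset (Fin m), IsLineDisjoint (minNonSimplices K) F :=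
  ⟨exists_isLineDisjoint_of_le_buchstaberInvariant, fun ⟨_, hF⟩ ↦ hF.le_buchstaberInvariant hs⟩

end Freeness

section Configurations

variable {α : Type*} [DecidableEq α] {N : Set (Finset α)}

/-- Configuration (a) of `ConditionS3`, repetitions allowed. -/
def ConfigurationA (N : Set (Finset α)) (τ₁ τ₂ τ₃ τ₄ τ₅ τ₆ τ₇ : Finset α) : Prop :=
  (∀ τ ∈ [τ₁, τ₂, τ₃, τ₄, τ₅, τ₆, τ₇], τ ∈ N) ∧
    τ₁ ∩ τ₂ ∩ τ₄ = ∅ ∧ τ₁ ∩ τ₃ ∩ τ₅ = ∅ ∧ τ₁ ∩ τ₆ ∩ τ₇ = ∅ ∧ τ₂ ∩ τ₃ ∩ τ₆ = ∅ ∧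
    τ₂ ∩ τ₅ ∩ τ₇ = ∅ ∧ τ₃ ∩ τ₄ ∩ τ₇ = ∅ ∧ τ₄ ∩ τ₅ ∩ τ₆ = ∅

/-- Configuration (b) of `ConditionS3`, repetitions allowed. -/
def ConfigurationB (N : Set (Finset α)) (τ₁ τ₂ τ₃ τ₄ τ₅ τ₆ : Finset α) : Prop :=
  (∀ τ ∈ [τ₁, τ₂, τ₃, τ₄, τ₅, τ₆], τ ∈ N) ∧
    τ₁ ∩ τ₃ = ∅ ∧ τ₁ ∩ τ₂ ∩ τ₄ = ∅ ∧ τ₁ ∩ τ₂ ∩ τ₅ = ∅ ∧ τ₁ ∩ τ₄ ∩ τ₆ = ∅ ∧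
    τ₁ ∩ τ₅ ∩ τ₆ = ∅ ∧ τ₂ ∩ τ₃ ∩ τ₆ = ∅ ∧ τ₃ ∩ τ₄ ∩ τ₅ = ∅

/-- Configuration (c) of `ConditionS3`, repetitions allowed. -/
def ConfigurationC (N : Set (Finset α)) (τ₁ τ₂ τ₃ τ₄ τ₅ : Finset α) : Prop :=
  (∀ τ ∈ [τ₁, τ₂, τ₃, τ₄, τ₅], τ ∈ N) ∧
    τ₁ ∩ τ₂ = ∅ ∧ τ₁ ∩ τ₅ = ∅ ∧ τ₁ ∩ τ₃ ∩ τ₄ = ∅ ∧ τ₂ ∩ τ₃ ∩ τ₅ = ∅ ∧ τ₂ ∩ τ₄ ∩ τ₅ = ∅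

/-- Configuration (d) of `ConditionS3`, repetitions allowed. -/
def ConfigurationD (N : Set (Finset α)) (τ₁ τ₂ τ₃ τ₄ : Finset α) : Prop :=
  (∀ τ ∈ [τ₁, τ₂, τ₃, τ₄], τ ∈ N) ∧ τ₁ ∩ (τ₂ ∪ τ₃ ∪ τ₄) = ∅ ∧ τ₂ ∩ τ₃ ∩ τ₄ = ∅

/-- Configuration (e) of `ConditionS3`, repetitions allowed. -/
def ConfigurationE (N : Set (Finset α)) (τ₁ τ₂ τ₃ : Finset α) : Prop :=
  (∀ τ ∈ [τ₁, τ₂, τ₃], τ ∈ N) ∧ τ₁ ∩ τ₂ = ∅ ∧ τ₁ ∩ τ₃ = ∅ ∧ τ₂ ∩ τ₃ = ∅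

theorem ConfigurationE.conditionS3 {A B C : Finset α} (h : ConfigurationE N A B C)
    (hN : ∅ ∉ N) : ConditionS3 N := by
  refine .inr (.inr (.inr (.inr ⟨A, B, C, ⟨?_, h.1⟩, h.2⟩)))
  grind [ConfigurationE]

theorem ConfigurationD.conditionS3 {A B C D : Finset α} (h : ConfigurationD N A B C D)
    (hN : ∅ ∉ N) : ConditionS3 N := by
  by_cases hBC : B ∩ C = ∅
  · exact (show ConfigurationE N A B C by grind [ConfigurationD, ConfigurationE]).conditionS3 hN
  by_cases hBD : B ∩ D = ∅
  · exact (show ConfigurationE N A B D by grind [ConfigurationD, ConfigurationE]).conditionS3 hN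
  by_cases hCD : C ∩ D = ∅
  · exact (show ConfigurationE N A C D by grind [ConfigurationD, ConfigurationE]).conditionS3 hN
  refine .inr (.inr (.inr (.inl ⟨A, B, C, D, ⟨?_, h.1⟩, h.2⟩)))
  grind [ConfigurationD]

theorem ConfigurationC.conditionS3 {A B C D E : Finset α} (h : ConfigurationC N A B C D E)
    (hN : ∅ ∉ N) : ConditionS3 N := by
  have hD {τ₁ τ₂ τ₃ τ₄ : Finset α} (h : ConfigurationD N τ₁ τ₂ τ₃ τ₄) := h.conditionS3 hN
  by_cases hBE : B ∩ E = ∅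
  · exact hD (show ConfigurationD N A B E B by grind [ConfigurationC, ConfigurationD])
  by_cases hAC : A ∩ C = ∅
  · exact hD (show ConfigurationD N A B E C by grind [ConfigurationC, ConfigurationD])
  by_cases hAD : A ∩ D = ∅
  · exact hD (show ConfigurationD N A B E D by grind [ConfigurationC, ConfigurationD])
  by_cases hBE' : B = E
  · exact hD (show ConfigurationD N B A C D by grind [ConfigurationC, ConfigurationD])
  refine .inr (.inr (.inl ⟨A, B, C, D, E, ⟨?_, h.1⟩, h.2⟩))
  obtain ⟨hN', h⟩ := h
  simp only [List.forall_mem_cons] at hN'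
  simp only [List.nodup_cons, List.mem_cons, List.not_mem_nil, or_false, not_or]
  and_intros <;> grind

theorem ConfigurationB.conditionS3 {A B C D E F : Finset α} (h : ConfigurationB N A B C D E F)
    (hN : ∅ ∉ N) : ConditionS3 N := by
  have hC {τ₁ τ₂ τ₃ τ₄ τ₅ : Finset α} (h : ConfigurationC N τ₁ τ₂ τ₃ τ₄ τ₅) := h.conditionS3 hN
  have hD {τ₁ τ₂ τ₃ τ₄ : Finset α} (h : ConfigurationD N τ₁ τ₂ τ₃ τ₄) := h.conditionS3 hN
  by_cases hCB : C ∩ B = ∅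
  · exact hC (show ConfigurationC N C A D E B by grind [ConfigurationB, ConfigurationC])
  by_cases hCF : C ∩ F = ∅
  · exact hC (show ConfigurationC N C A D E F by grind [ConfigurationB, ConfigurationC])
  by_cases hCD : C ∩ D = ∅
  · exact hC (show ConfigurationC N C A B F D by grind [ConfigurationB, ConfigurationC])
  by_cases hCE : C ∩ E = ∅
  · exact hC (show ConfigurationC N C A B F E by grind [ConfigurationB, ConfigurationC])
  by_cases hADE : A ∩ D = ∅ ∧ A ∩ E = ∅
  · exact hD (show ConfigurationD N A C D E by grind [ConfigurationB, ConfigurationD])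
  by_cases hABF : A ∩ B = ∅ ∧ A ∩ F = ∅
  · exact hD (show ConfigurationD N A C B F by grind [ConfigurationB, ConfigurationD])
  by_cases hBD : B = D
  · exact hC (show ConfigurationC N A C F E B by grind [ConfigurationB, ConfigurationC])
  by_cases hDF : D = F
  · exact hC (show ConfigurationC N A C E B D by grind [ConfigurationB, ConfigurationC])
  by_cases hFE : F = E
  · exact hC (show ConfigurationC N A C B D F by grind [ConfigurationB, ConfigurationC])
  by_cases hBE : B = E
  · exact hC (show ConfigurationC N A C D F B by grind [ConfigurationB, ConfigurationC])
  refine .inr (.inl ⟨A, B, C, D, E, F, ⟨?_, h.1⟩, h.2⟩)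
  obtain ⟨hN', h⟩ := h
  simp only [List.forall_mem_cons] at hN'
  simp only [List.nodup_cons, List.mem_cons, List.not_mem_nil, or_false, not_or]
  and_intros <;> grind

theorem ConditionS3.exists_configurationA (h : ConditionS3 N) :
    ∃ τ₁ τ₂ τ₃ τ₄ τ₅ τ₆ τ₇, ConfigurationA N τ₁ τ₂ τ₃ τ₄ τ₅ τ₆ τ₇ := by
  rcases h with ⟨a, b, c, d, e, f, g, ⟨-, hN⟩, h⟩ | ⟨a, b, c, d, e, f, ⟨-, hN⟩, h⟩ |
    ⟨a, b, c, d, e, ⟨-, hN⟩, h⟩ | ⟨a, b, c, d, ⟨-, hN⟩, h⟩ | ⟨a, b, c, ⟨-, hN⟩, h⟩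
  · exact ⟨a, b, c, d, e, f, g, hN, h⟩
  · exact ⟨a, a, b, c, d, e, f, by grind [ConfigurationA]⟩
  · exact ⟨b, b, e, a, c, d, e, by grind [ConfigurationA]⟩
  · exact ⟨a, a, a, b, c, d, a, by grind [ConfigurationA]⟩
  · exact ⟨a, a, a, b, c, b, a, by grind [ConfigurationA]⟩

theorem IsLineDisjoint.of_forall_exists_notMem {V : Type*} [AddCommGroup V] [Module (ZMod 2) V]
    [DecidableEq V] {F : V → Finset α} (hmem : ∀ u, u ≠ 0 → F u ∈ N)
    (h : ∀ u v, u ≠ 0 → v ≠ 0 → u + v ≠ 0 → ∀ i, ∃ x ∈ ({u, v, u + v} : Finset V), i ∉ F x) :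
    IsLineDisjoint N F := by
  refine ⟨hmem, fun u v w hu hv hw huvw ↦ Finset.eq_empty_of_forall_notMem fun i hi ↦ ?_⟩
  obtain rfl : w = u + v := by rw [← neg_eq_of_add_eq_zero_right huvw, ZModModule.neg_eq_self]
  obtain ⟨x, hx, hix⟩ := h u v hu hv hw i
  simp only [Finset.mem_inter] at hi
  simp only [Finset.mem_insert, Finset.mem_singleton] at hx
  obtain rfl | rfl | rfl := hx
  exacts [hix hi.1.1, hix hi.1.2, hix hi.2]

theorem eq_of_ne_zero_fin_three : ∀ u : Fin 3 → ZMod 2, u ≠ 0 →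
    u = ![1, 0, 0] ∨ u = ![0, 1, 0] ∨ u = ![0, 0, 1] ∨ u = ![1, 1, 0] ∨ u = ![1, 0, 1] ∨
      u = ![0, 1, 1] ∨ u = ![1, 1, 1] := by decide

theorem line_mem_fano : ∀ u v : Fin 3 → ZMod 2, u ≠ 0 → v ≠ 0 → u + v ≠ 0 →
    ({u, v, u + v} : Finset (Fin 3 → ZMod 2)) ∈ [
      {![1, 0, 0], ![0, 1, 0], ![1, 1, 0]}, {![1, 0, 0], ![0, 0, 1], ![1, 0, 1]},
      {![1, 0, 0], ![0, 1, 1], ![1, 1, 1]}, {![0, 1, 0], ![0, 0, 1], ![0, 1, 1]},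
      {![0, 1, 0], ![1, 0, 1], ![1, 1, 1]}, {![0, 0, 1], ![1, 1, 0], ![1, 1, 1]},
      {![1, 1, 0], ![1, 0, 1], ![0, 1, 1]}] := by decide +kernel

theorem ConfigurationA.isLineDisjoint {F : (Fin 3 → ZMod 2) → Finset α}
    (h : ConfigurationA N (F ![1, 0, 0]) (F ![0, 1, 0]) (F ![0, 0, 1]) (F ![1, 1, 0])
      (F ![1, 0, 1]) (F ![0, 1, 1]) (F ![1, 1, 1])) : IsLineDisjoint N F := by
  obtain ⟨hN, h₁, h₂, h₃, h₄, h₅, h₆, h₇⟩ := h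
  refine .of_forall_exists_notMem (fun u hu ↦ ?_) fun u v hu hv huv i ↦ ?_
  · obtain rfl | rfl | rfl | rfl | rfl | rfl | rfl := eq_of_ne_zero_fin_three u hu <;>
      exact hN _ (by simp)
  · have hinter {A B C : Finset α} (h : A ∩ B ∩ C = ∅) : ¬ (i ∈ A ∧ i ∈ B ∧ i ∈ C) := by
      rw [← Finset.mem_inter, ← Finset.mem_inter, ← Finset.inter_assoc, h]
      exact Finset.notMem_empty i
    by_contra! hmem
    have hfano := line_mem_fano u v hu hv huv
    simp only [List.mem_cons, List.not_mem_nil, or_false] at hfano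
    obtain h | h | h | h | h | h | h := hfano <;>
      simp only [h, Finset.mem_insert, Finset.mem_singleton, forall_eq_or_imp, forall_eq] at hmem
    exacts [hinter h₁ hmem, hinter h₂ hmem, hinter h₃ hmem, hinter h₄ hmem, hinter h₅ hmem,
      hinter h₆ hmem, hinter h₇ hmem]

theorem IsLineDisjoint.configurationA {F : (Fin 3 → ZMod 2) → Finset α}
    (hF : IsLineDisjoint N F) :
    ConfigurationA N (F ![1, 0, 0]) (F ![0, 1, 0]) (F ![0, 0, 1]) (F ![1, 1, 0])
      (F ![1, 0, 1]) (F ![0, 1, 1]) (F ![1, 1, 1]) := by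
  refine ⟨?_, ?_⟩
  · simp only [List.forall_mem_cons, List.not_mem_nil, false_imp_iff, implies_true, and_true]
    and_intros <;> exact hF.mem _ (by decide)
  · and_intros <;> exact hF.inter_eq_empty _ _ _ (by decide) (by decide) (by decide) (by decide)

theorem ConfigurationA.exists_isLineDisjoint {τ₁ τ₂ τ₃ τ₄ τ₅ τ₆ τ₇ : Finset α}
    (h : ConfigurationA N τ₁ τ₂ τ₃ τ₄ τ₅ τ₆ τ₇) :
    ∃ F : (Fin 3 → ZMod 2) → Finset α, IsLineDisjoint N F :=
  ⟨fun u ↦ ![![![∅, τ₃], ![τ₂, τ₆]], ![![τ₁, τ₅], ![τ₄, τ₇]]] (u 0) (u 1) (u 2), h.isLineDisjoint⟩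

theorem IsLineDisjoint.conditionS3_of_eq {F : (Fin 3 → ZMod 2) → Finset α}
    (hF : IsLineDisjoint N F) (hN : ∅ ∉ N) {u v : Fin 3 → ZMod 2} (hu : u ≠ 0) (hv : v ≠ 0)
    (huv : u ≠ v) (hFuv : F u = F v) : ConditionS3 N := by
  obtain ⟨w, hw, huw, hvw, huvw⟩ :
      ∃ w, w ≠ 0 ∧ u + w ≠ 0 ∧ v + w ≠ 0 ∧ u + v + w ≠ 0 := by
    clear hu hv huv hFuv
    decide +kernel +revert
  have huv₀ : u + v ≠ 0 := by rwa [Ne, ← ZModModule.sub_eq_add, sub_eq_zero]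
  have htwo : (2 : Fin 3 → ZMod 2) = 0 := CharTwo.two_eq_zero
  have h : ConfigurationB N (F u) (F w) (F (u + v)) (F (u + w)) (F (v + w)) (F (u + v + w)) := by
    have h₁ := hF.inter_eq_empty u v (u + v) hu hv huv₀ (by linear_combination (u + v) * htwo)
    have h₂ := hF.inter_eq_empty u w (u + w) hu hw huw (by linear_combination (u + w) * htwo)
    have h₃ := hF.inter_eq_empty v w (v + w) hv hw hvw (by linear_combination (v + w) * htwo)
    have h₄ := hF.inter_eq_empty v (u + w) (u + v + w) hv huw huvw
      (by linear_combination (u + v + w) * htwo)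
    have h₅ := hF.inter_eq_empty u (v + w) (u + v + w) hu hvw huvw
      (by linear_combination (u + v + w) * htwo)
    have h₆ := hF.inter_eq_empty w (u + v) (u + v + w) hw huv₀ huvw
      (by linear_combination (u + v + w) * htwo)
    have h₇ := hF.inter_eq_empty (u + v) (u + w) (v + w) huv₀ huw hvw
      (by linear_combination (u + v + w) * htwo)
    rw [← hFuv] at h₁ h₃ h₄
    refine ⟨?_, by rwa [Finset.inter_self] at h₁, h₂, h₃, h₄, h₅, h₆, h₇⟩
    simp [hF.mem, *]
  exact h.conditionS3 hN

theorem IsLineDisjoint.conditionS3 {F : (Fin 3 → ZMod 2) → Finset α}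
    (hF : IsLineDisjoint N F) (hN : ∅ ∉ N) : ConditionS3 N := by
  by_cases h : ∃ u v, u ≠ 0 ∧ v ≠ 0 ∧ u ≠ v ∧ F u = F v
  · obtain ⟨u, v, hu, hv, huv, hFuv⟩ := h
    exact hF.conditionS3_of_eq hN hu hv huv hFuv
  push Not at h
  refine .inl ⟨_, _, _, _, _, _, _, ⟨?_, hF.configurationA.1⟩, hF.configurationA.2⟩
  have hnodup : [![1, 0, 0], ![0, 1, 0], ![0, 0, 1], ![1, 1, 0], ![1, 0, 1], ![0, 1, 1],
    (![1, 1, 1] : Fin 3 → ZMod 2)].Nodup := by decide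
  have hne : ∀ u ∈ [![1, 0, 0], ![0, 1, 0], ![0, 0, 1], ![1, 1, 0], ![1, 0, 1], ![0, 1, 1],
    (![1, 1, 1] : Fin 3 → ZMod 2)], u ≠ 0 := by decide
  exact hnodup.map_on (f := F) fun u hu v hv hFuv ↦
    by_contra fun huv ↦ h u v (hne u hu) (hne v hv) huv hFuv

theorem conditionS3_iff_exists_isLineDisjoint (hN : ∅ ∉ N) :
    ConditionS3 N ↔ ∃ F : (Fin 3 → ZMod 2) → Finset α, IsLineDisjoint N F := by
  constructor
  · intro h
    obtain ⟨_, _, _, _, _, _, _, h⟩ := h.exists_configurationA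
    exact h.exists_isLineDisjoint
  · rintro ⟨F, hF⟩
    exact hF.conditionS3 hN

theorem conditionS2_iff_exists_inter_eq_empty (hN : ∅ ∉ N) :
    ConditionS2 N ↔ ∃ A ∈ N, ∃ B ∈ N, ∃ C ∈ N, A ∩ B ∩ C = ∅ := by
  constructor
  · rintro (⟨A, B, C, ⟨-, hmem⟩, h⟩ | ⟨A, B, ⟨-, hmem⟩, h⟩)
    · exact ⟨A, by grind, B, by grind, C, by grind, h⟩
    · exact ⟨A, by grind, B, by grind, A, by grind, by grind⟩
  · rintro ⟨A, hA, B, hB, C, hC, h⟩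
    have hpair {X Y : Finset α} (hX : X ∈ N) (hY : Y ∈ N) (hXY : X ∩ Y = ∅) : ConditionS2 N := by
      have hne : X ≠ Y := by
        rintro rfl
        rw [Finset.inter_self] at hXY
        exact hN (hXY ▸ hX)
      exact .inr ⟨X, Y, ⟨by simp [hne], by simp [hX, hY]⟩, hXY⟩
    by_cases hAB : A = B
    · exact hpair hA hC (by rwa [← hAB, Finset.inter_self] at h)
    by_cases hAC : A = C
    · exact hpair hA hB (by rwa [← hAC, Finset.inter_right_comm, Finset.inter_self] at h)
    by_cases hBC : B = C
    · exact hpair hA hB (by rwa [← hBC, Finset.inter_assoc, Finset.inter_self] at h)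
    exact .inl ⟨A, B, C, ⟨by simp [hAB, hAC, hBC], by simp [hA, hB, hC]⟩, h⟩

theorem eq_of_ne_zero_fin_two : ∀ u : Fin 2 → ZMod 2, u ≠ 0 →
    u = ![1, 0] ∨ u = ![0, 1] ∨ u = ![1, 1] := by decide

theorem line_eq_fin_two : ∀ u v : Fin 2 → ZMod 2, u ≠ 0 → v ≠ 0 → u + v ≠ 0 →
    ({u, v, u + v} : Finset (Fin 2 → ZMod 2)) = {![1, 0], ![0, 1], ![1, 1]} := by decide

theorem conditionS2_iff_exists_isLineDisjoint (hN : ∅ ∉ N) :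
    ConditionS2 N ↔ ∃ F : (Fin 2 → ZMod 2) → Finset α, IsLineDisjoint N F := by
  rw [conditionS2_iff_exists_inter_eq_empty hN]
  constructor
  · rintro ⟨A, hA, B, hB, C, hC, h⟩
    refine ⟨fun u ↦ ![![∅, B], ![A, C]] (u 0) (u 1), .of_forall_exists_notMem (fun u hu ↦ ?_)
      fun u v hu hv huv i ↦ ?_⟩
    · obtain rfl | rfl | rfl := eq_of_ne_zero_fin_two u hu
      exacts [hA, hB, hC]
    · have hi : ¬ ((i ∈ A ∧ i ∈ B) ∧ i ∈ C) := by
        rw [← Finset.mem_inter, ← Finset.mem_inter, h]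
        exact Finset.notMem_empty i
      by_contra! hmem
      rw [line_eq_fin_two u v hu hv huv] at hmem
      exact hi ⟨⟨hmem ![1, 0] (by simp), hmem ![0, 1] (by simp)⟩, hmem ![1, 1] (by simp)⟩
  · rintro ⟨F, hF⟩
    exact ⟨F ![1, 0], hF.mem _ (by decide), F ![0, 1], hF.mem _ (by decide), F ![1, 1],
      hF.mem _ (by decide),
      hF.inter_eq_empty _ _ _ (by decide) (by decide) (by decide) (by decide)⟩

theorem conditionS1_iff_exists_isLineDisjoint :
    ConditionS1 N ↔ ∃ F : (Fin 1 → ZMod 2) → Finset α, IsLineDisjoint N F := by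
  constructor
  · rintro ⟨τ, hτ⟩
    have hsum : ∀ u v : Fin 1 → ZMod 2, u ≠ 0 → v ≠ 0 → u + v = 0 := by decide
    exact ⟨fun _ ↦ τ, .of_forall_exists_notMem (fun _ _ ↦ hτ)
      fun u v hu hv huv ↦ absurd (hsum u v hu hv) huv⟩
  · rintro ⟨F, hF⟩
    exact ⟨F 1, hF.mem 1 (by decide)⟩

end Configurations

end BuchstaberInv

theorem mainTheorem1 (m : ℕ) (K : PreAbstractSimplicialComplex (Fin m)) :
    (1 ≤ BuchstaberInv.buchstaberInvariant K ↔
      BuchstaberInv.ConditionS1 (BuchstaberInv.minNonSimplices K)) ∧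
    (BuchstaberInv.ConditionS1 (BuchstaberInv.minNonSimplices K) ↔
      ¬ ∀ σ : Finset (Fin m), BuchstaberInv.IsSimplex K σ) ∧
    (2 ≤ BuchstaberInv.buchstaberInvariant K ↔
      BuchstaberInv.ConditionS2 (BuchstaberInv.minNonSimplices K)) ∧
    (3 ≤ BuchstaberInv.buchstaberInvariant K ↔
      BuchstaberInv.ConditionS3 (BuchstaberInv.minNonSimplices K)) := by
  have hN : ∅ ∉ BuchstaberInv.minNonSimplices K := BuchstaberInv.empty_notMem_minNonSimplices
  refine ⟨?_, BuchstaberInv.conditionS1_iff, ?_, ?_⟩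
  · rw [BuchstaberInv.le_buchstaberInvariant_iff (by norm_num),
      BuchstaberInv.conditionS1_iff_exists_isLineDisjoint]
  · rw [BuchstaberInv.le_buchstaberInvariant_iff (by norm_num),
      BuchstaberInv.conditionS2_iff_exists_isLineDisjoint hN]
  · rw [BuchstaberInv.le_buchstaberInvariant_iff le_rfl,
      BuchstaberInv.conditionS3_iff_exists_isLineDisjoint hN]
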